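/- Let $G=(V,E)$ be a finite graph without loops (parallel edges are allowed) and let $R$ be a finite multiset of vertices of $G$, the roots. For $v\in V$ let $R_v$ be the multiset of the elements of $R$ equal to $v$; for $F\subseteq E$ let $V(F)$ be the set of vertices incident to an edge of $F$ and $R_F=\bigcup_{v\in V(F)}R_v$ (as a multiset). Identify a line of the projective plane $\mathbb{P}^2=\mathbb{P}(\mathbb{R}^3)$ with its Plücker coordinates in $\bigwedge^2\mathbb{R}^3$ (defined up to a nonzero factor), write $\langle a,b\rangle=a\cdot(\ast b)$ for $a\in\mathbb{R}^3$, $b\in\bigwedge^2\mathbb{R}^3$, where $\ast$ is the Hodge star, and let $b^\circ:R\to Gr(2,\mathbb{R}^3)$, $r\mapsto b^\circ_r$, assign to every root a line of $\mathbb{P}^2$. A map $\tilde p:V\to\mathbb{P}^2$ makes $(G,R;\tilde p,b^\circ)$ a bar-joint framework with bar-boundary if $\tilde p$ is injective and $\langle \tilde p_v,b^\circ_r\rangle=0$ for all $v\in V$, $r\in R_v$. Let $b_{uv}$ be the line through $\tilde p_u$ and $\tilde p_v$ for $uv\in E$. An infinitesimal motion is a map $m:V\to\mathbb{R}^3$ with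 $\langle m(u)-m(v),b_{e}\rangle=0$ for every edge $e=uv\in E$ and $\langle m(v),b^\circ_r\rangle=0$ for $v\in V$, $r\in R_v$. The framework is infinitesimally rigid if every infinitesimal motion is a linear combination of the trivial danglings $m_v$ ($v\in V$), where $m_v(v)=\tilde p_v$ and $m_v(u)=0$ for $u\ne v$. It is minimally infinitesimally rigid if it is infinitesimally rigid and the removal of any single bar (edge) or boundary-bar (root) destroys this. **Theorem.** Suppose that the set of lines $b^\circ(R)$ is in general position, i.e. no three distinct lines of the set meet in a point, and that no two distinct vertices of $G$ both carry the same pair of distinct boundary lines (that is, there are no vertices $u\neq v$, roots $r,r'\in R_u$ and $s,s'\in R_v$ with $b^\circ_r=b^\circ_s\ne b^\circ_{r'}=b^\circ_{s'}$; this is automatic if different roots have different lines). Then there is $\tilde p:V\to\mathbb{P}^2$ such that $(G,R;\tilde p,b^\circ)$ is a minimally infinitesimally rigid bar-joint framework with bar-boundary if and only if the following three conditions hold: 1. $|R_v|\le 2$ and the family $(b^\circ_r)_{r\in R_v}$ is linearly independent, for each $v\in V$; 2. $|F|+|R_F|\le 2|V(F)|-3+\dim\operatorname{span}\{b^\circ_r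 : r\in R_F\}$ for every non-empty $F\subseteq E$; 3. $|E|+|R|=2|V|$. -/

import Mathlib

open scoped LinearAlgebra.Projectivization

/-- The coordinate space `ℝ³` of the projective plane. It is also the space `⋀¹ℝ³` in which the
infinitesimal motions of planar bodies take their values. -/
abbrev Vec3 : Type := Fin 3 → ℝ

/-- The exterior square `⋀²ℝ³`, identified with `ℝ³` through the coordinates with respect to the
basis `e₁ ∧ e₂`, `e₁ ∧ e₃`, `e₂ ∧ e₃`. -/
abbrev Ext2 : Type := Fin 3 → ℝ

/-- The real projective plane `ℙ²`. -/
abbrev ProjPlane : Type := ℙ ℝ Vec3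

/-- The Grassmannian `Gr(2, ℝ³)`, that is, the set of lines of the projective plane. -/
abbrev ProjLine : Type := {W : Submodule ℝ Vec3 // Module.finrank ℝ W = 2}

/-- The exterior product `x ∧ y`; its coordinates are the `2 × 2` minors of the matrix with rows
`x` and `y`. -/
def wedge (x y : Vec3) : Ext2 :=
  ![x 0 * y 1 - x 1 * y 0, x 0 * y 2 - x 2 * y 0, x 1 * y 2 - x 2 * y 1]

/-- The Hodge dual `∗b ∈ ⋀¹ℝ³ = ℝ³` of `b ∈ ⋀²ℝ³`. -/
def hodgeStar (b : Ext2) : Vec3 := ![b 2, -b 1, b 0]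

/-- The pairing `⟨a, b⟩ = ⟨a, ∗b⟩` of `a ∈ ⋀¹ℝ³` with `b ∈ ⋀²ℝ³`. -/
def pairing (a : Vec3) (b : Ext2) : ℝ := a ⬝ᵥ hodgeStar b

open Classical in
/-- A vector of Plücker coordinates of a two-dimensional subspace `W` of `ℝ³`: the exterior
product `x ∧ y` of some basis `x, y` of `W` (it is determined up to a nonzero factor).
It is `0` if the subspace `W` is not two-dimensional. -/
noncomputable def pluckerVec (W : Submodule ℝ Vec3) : Ext2 :=
  if h : ∃ xy : Vec3 × Vec3,
      LinearIndependent ℝ ![xy.1, xy.2] ∧ Submodule.span ℝ {xy.1, xy.2} = W then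
    wedge h.choose.1 h.choose.2
  else 0

/-- The incidence `⟨q, b⟩ = 0` of a point with a line of the projective plane. -/
def Incident (q : ProjPlane) (L : ProjLine) : Prop := pairing q.rep (pluckerVec L.1) = 0

/-- A set of projective lines is in general position if no three (distinct) lines of the set
intersect at a point. -/
def InGeneralPosition (S : Set ProjLine) : Prop :=
  ∀ L₁ ∈ S, ∀ L₂ ∈ S, ∀ L₃ ∈ S, L₁ ≠ L₂ → L₁ ≠ L₃ → L₂ ≠ L₃ →
    ¬ ∃ q : ProjPlane, Incident q L₁ ∧ Incident q L₂ ∧ Incident q L₃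

/-- A graph with roots: a graph with vertex set `V` and edge set `E` (parallel edges are allowed,
loops are not) together with a multiset of vertices, given as a family indexed by `R`. -/
structure RootedGraph (V E R : Type*) where
  /-- the two ends of an edge -/
  ends : E → Sym2 V
  /-- there are no loops -/
  ends_not_isDiag : ∀ e, ¬ (ends e).IsDiag
  /-- the vertex at which a root is placed -/
  root : R → V

namespace RootedGraph

variable {V E R : Type*} (G : RootedGraph V E R)

/-- The set `R_v` of the roots at the vertex `v`. -/
def rootsAt (v : V) : Set R := {r | G.root r = v}

/-- The set `V(F)` of the vertices that are incident to some edge of `F`. -/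
def vertsOf (F : Set E) : Set V := {v | ∃ e ∈ F, v ∈ G.ends e}

/-- The set `R_F` of the roots placed at vertices of `V(F)`. -/
def rootsOf (F : Set E) : Set R := {r | G.root r ∈ G.vertsOf F}

/-- `m : V → ⋀¹ℝ³` is an infinitesimal motion of the planar body-bar framework with bar-boundary
whose graph has the edges in `F`, whose boundary-bars are those in `S`, and whose bars and
boundary-bars have the Plücker coordinates `b` and `b₀`. -/
def IsMotion (b : E → Ext2) (b₀ : R → Ext2) (F : Set E) (S : Set R) (m : V → Vec3) : Prop :=
  (∀ e ∈ F, ∀ u v : V, G.ends e = s(u, v) → pairing (m u - m v) (b e) = 0) ∧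
    ∀ r ∈ S, pairing (m (G.root r)) (b₀ r) = 0

/-- The Plücker coordinates of the bar of the edge `e = uv` that is determined by the joint
placement `p`, that is, of the projective line through `p u` and `p v`. -/
noncomputable def bar (p : V → ProjPlane) (e : E) : Ext2 :=
  pluckerVec (⨆ v ∈ G.ends e, (p v).submodule)

/-- `(G, R; p, b₀)` is a bar-joint framework with bar-boundary in the projective plane: the joints
are distinct points, and every boundary-bar at a vertex is a line through the joint. -/
def IsBarJointFramework (p : V → ProjPlane) (b₀ : R → ProjLine) : Prop :=
  Function.Injective p ∧ ∀ r, Incident (p (G.root r)) (b₀ r)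

open Classical in
/-- The trivial dangling around `v`: the vertex `v` gets the vector `p v`, every other vertex
gets `0`. -/
noncomputable def dangling (p : V → ProjPlane) (v : V) : V → Vec3 := Pi.single v (p v).rep

/-- Infinitesimal rigidity of the framework with the bars in `F` and the boundary-bars in `S`: the
derived body-bar framework is bar-joint-rigid, i.e. each of its motions is a linear combination of
trivial danglings. -/
def IsInfRigidOn (p : V → ProjPlane) (b₀ : R → ProjLine) (F : Set E) (S : Set R) : Prop :=
  ∀ m : V → Vec3, G.IsMotion (G.bar p) (fun r => pluckerVec (b₀ r).1) F S m →
    m ∈ Submodule.span ℝ (Set.range (dangling p))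

/-- Minimal infinitesimal rigidity: the framework is infinitesimally rigid, and it is no longer so
after the removal of any bar or of any boundary-bar. -/
def IsMinInfRigid (p : V → ProjPlane) (b₀ : R → ProjLine) : Prop :=
  G.IsInfRigidOn p b₀ Set.univ Set.univ ∧
    (∀ e : E, ¬ G.IsInfRigidOn p b₀ {e}ᶜ Set.univ) ∧
    ∀ r : R, ¬ G.IsInfRigidOn p b₀ Set.univ {r}ᶜ

end RootedGraph

/-! A framework is minimally infinitesimally rigid exactly when the rows of its rigidity matrix are
independent and |E| + |R| = 2|V|: the danglings always span a |V|-dimensional space of motions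
inside a space of dimension 3|V| (`isMinInfRigid_iff`).

Necessity. At a vertex, the boundary normals are independent and orthogonal to the joint, so there
are at most two. On V(F), adding a common vector orthogonal to all normals of R_F to any dangling
respects the rows of F and R_F; this space of motions bounds the number of independent rows.

Sufficiency. Fix a vector φ that, at each vertex, lies outside the span of the boundary normals
there, and look for joints q in an affine chart φ · q = const ≠ 0. All conditions on q are linear
functionals on assignments V → ℝ³. Let S be spanned by the boundary rows and the differences of
φ-values; its dimension is |V| + |R| - 1. Each edge uv offers a whole flat of functionals m ↦ x · (m
u - m v). Dilworth truncation (`exists_generic_transversal`) picks one functional from each edge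
flat, independent modulo S, so that with S they span a T containing no flat of a pair of distinct
vertices and not the φ-value itself. By the count, dim T = 3|V| - 1, so T is the annihilator of a
single q. This q is the placement: it satisfies the boundary incidences, is injective since T
contains no pair flat, and has nonzero φ-value. Modulo φ, the chosen x is the normal of the line
through q u and q v, so the rigidity matrix has full rank 2|V|.

The truncation needs a rank bound for every family of flats
(`finrank_add_card_le_finrank_sup_flats`). It is proved by splitting the vertices into the
components of the family and applying the sparsity count to each one. General position and
separation of line pairs make that count nonnegative on every set of at least two vertices, even
without edges (`maxEdges_nonneg`). -/

open Module

/-! ### Linear algebra: generic vectors and Dilworth truncation -/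

/-- A subspace of a vector space over an infinite field that is contained in none of finitely many
subspaces has a vector that lies outside of all of them. -/
theorem Submodule.exists_mem_forall_notMem {K W ι : Type*} [Field K] [Infinite K] [AddCommGroup W]
    [Module K W] [Finite ι] (A : Submodule K W) (B : ι → Submodule K W) (h : ∀ i, ¬ A ≤ B i) :
    ∃ x ∈ A, ∀ i, x ∉ B i := by
  obtain ⟨x, hx⟩ := Submodule.exists_forall_notMem_of_forall_ne_top
    (fun i => (B i).comap A.subtype) (fun i hi => h i fun y hy => by
      have : (⟨y, hy⟩ : A) ∈ (B i).comap A.subtype := by rw [hi]; trivial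
      simpa using this)
  exact ⟨x, x.2, fun i hi => hx i (by simpa using hi)⟩

/-- Adding a vector to a subspace raises the dimension by one exactly if the vector is new. -/
theorem Submodule.finrank_sup_span_singleton_of_notMem {K W : Type*} [Field K] [AddCommGroup W]
    [Module K W] [FiniteDimensional K W] {S : Submodule K W} {x : W} (hx : x ∉ S) :
    finrank K ↥(S ⊔ K ∙ x) = finrank K S + 1 := by
  have h0 : x ≠ 0 := fun h => hx (h ▸ S.zero_mem)
  have hd : S ⊓ K ∙ x = ⊥ := by
    rw [← disjoint_iff]
    exact Submodule.disjoint_span_singleton_of_notMem hx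
  have := Submodule.finrank_sup_add_finrank_inf_eq S (K ∙ x)
  rw [hd, finrank_bot, finrank_span_singleton h0] at this
  omega

/-- Dilworth truncation for subspaces: if, modulo `S`, the span of every non-empty subfamily `F`
of `A` has dimension larger than the number of the members of `F` in `J`, then there are vectors
`x j ∈ A j` for `j ∈ J`, linearly independent modulo `S`, such that `S` and these vectors together
do not span any of the subspaces `A i`. -/
theorem exists_generic_transversal {K W ι : Type*} [Field K] [Infinite K] [AddCommGroup W]
    [Module K W] [FiniteDimensional K W] [Fintype ι] [DecidableEq ι] (A : ι → Submodule K W) (J : Finset ι)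
    (S : Submodule K W)
    (h : ∀ F : Finset ι, F.Nonempty →
      finrank K S + (F ∩ J).card + 1 ≤ finrank K ↥(S ⊔ F.sup A)) :
    ∃ T : Submodule K W, S ≤ T ∧ finrank K S + J.card ≤ finrank K T ∧ (∀ i, ¬ A i ≤ T) ∧
      ∃ x : ι → W, (∀ j ∈ J, x j ∈ A j) ∧ T = S ⊔ Submodule.span K (x '' J) := by
  induction J using Finset.induction_on generalizing S with
  | empty =>
    refine ⟨S, le_rfl, by simp, fun i hi => ?_, 0, by simp, by simp⟩
    have := h {i} (Finset.singleton_nonempty i)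
    rw [Finset.sup_singleton, sup_eq_left.2 hi] at this
    omega
  | insert j J hj ih =>
    -- A generic y in `A j`: it lies in a span S + ∑ A i only when all of `A j` does.
    obtain ⟨y, hyA, hy⟩ := (A j).exists_mem_forall_notMem
      (fun F : {F : Finset ι // ¬ A j ≤ S ⊔ F.sup A} => S ⊔ F.1.sup A) (fun F => F.2)
    have key : ∀ F : Finset ι, y ∈ S ⊔ F.sup A → A j ≤ S ⊔ F.sup A := fun F hF => by
      by_contra hc
      exact hy ⟨F, hc⟩ hF
    have hyS : y ∉ S := fun hyS => by
      have h1 := key ∅ (by simpa using hyS)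
      have h2 := h {j} (Finset.singleton_nonempty j)
      rw [Finset.sup_empty, sup_bot_eq] at h1
      rw [Finset.sup_singleton, sup_eq_left.2 h1] at h2
      omega
    have hfS := Submodule.finrank_sup_span_singleton_of_notMem hyS
    obtain ⟨T, hST, hT, hAT, x, hxA, hTx⟩ := ih (S ⊔ K ∙ y) fun F hF => by
      have hcard : (F ∩ J).card ≤ (F ∩ insert j J).card :=
        Finset.card_le_card (Finset.inter_subset_inter_left (Finset.subset_insert _ _))
      rw [sup_right_comm, hfS]
      -- Replacing S by S + ⟨y⟩ costs one dimension. If y is already in the span of F, then j joins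
      -- F without enlarging that span, and the hypothesis for F ∪ {j} gains the missing one.
      by_cases hyF : y ∈ S ⊔ F.sup A
      · have hle := key F hyF
        rw [sup_eq_left.2 ((Submodule.span_singleton_le_iff_mem _ _).2 hyF)]
        have h1 := h (insert j F) (Finset.insert_nonempty _ _)
        rw [Finset.sup_insert, sup_left_comm, sup_eq_right.2 hle] at h1
        have h2 : (F ∩ J).card + 1 ≤ (insert j F ∩ insert j J).card := by
          rw [← Finset.insert_inter_distrib, Finset.card_insert_of_notMem]
          exact fun hc => hj (Finset.mem_inter.1 hc).2
        omega
      · rw [Submodule.finrank_sup_span_singleton_of_notMem hyF]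
        have := h F hF
        omega
    refine ⟨T, le_sup_left.trans hST, ?_, hAT, Function.update x j y, fun i hi => ?_, ?_⟩
    · rw [Finset.card_insert_of_notMem hj]
      omega
    · rcases eq_or_ne i j with rfl | hij
      · simpa using hyA
      · rw [Function.update_of_ne hij]
        exact hxA i ((Finset.mem_insert.1 hi).resolve_left hij)
    · have himg : Function.update x j y '' J = x '' J := Set.image_congr fun i hi =>
        Function.update_of_ne (ne_of_mem_of_not_mem (Finset.mem_coe.1 hi) hj) _ _
      rw [hTx, Finset.coe_insert, Set.image_insert_eq, Function.update_self, himg,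
        Submodule.span_insert, sup_assoc]

/-! ### Normal vectors and orthogonality in ℝ³ -/

/-- The normal vector of a plane `W` of `ℝ³` that is given by the Plücker coordinates. -/
noncomputable def normalVec (W : Submodule ℝ Vec3) : Vec3 := hodgeStar (pluckerVec W)

theorem hodgeStar_wedge_eq_cross (x y : Vec3) : hodgeStar (wedge x y) = crossProduct x y := by
  ext i
  fin_cases i <;> simp [hodgeStar, wedge, cross_apply]

/-- The Hodge star as a linear isomorphism. -/
def hodgeStarEquiv : Ext2 ≃ₗ[ℝ] Vec3 where
  toFun := hodgeStar
  map_add' x y := by ext i; fin_cases i <;> simp [hodgeStar]; ring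
  map_smul' c x := by ext i; fin_cases i <;> simp [hodgeStar]
  invFun y := ![y 2, -y 1, y 0]
  left_inv x := by ext i; fin_cases i <;> simp [hodgeStar]
  right_inv x := by ext i; fin_cases i <;> simp [hodgeStar]

theorem Submodule.mem_dualCoannihilator_span {K W : Type*} [Field K] [AddCommGroup W] [Module K W]
    {s : Set (Dual K W)} {x : W} :
    x ∈ (Submodule.span K s).dualCoannihilator ↔ ∀ φ ∈ s, φ x = 0 := by
  rw [Submodule.mem_dualCoannihilator]
  refine ⟨fun h φ hφ => h φ (Submodule.subset_span hφ), fun h φ hφ => ?_⟩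
  induction hφ using Submodule.span_induction with
  | mem φ hφ => exact h φ hφ
  | zero => rfl
  | add a b _ _ ha hb => rw [LinearMap.add_apply, ha, hb, add_zero]
  | smul c a _ ha => rw [LinearMap.smul_apply, ha, smul_zero]

/-- The subspace of the vectors of `ℝ³` orthogonal to all vectors of a set. -/
def perp (N : Set Vec3) : Submodule ℝ Vec3 where
  carrier := {x | ∀ n ∈ N, n ⬝ᵥ x = 0}
  add_mem' ha hb n hn := by rw [dotProduct_add, ha n hn, hb n hn, add_zero]
  zero_mem' n _ := dotProduct_zero n
  smul_mem' c x hx n hn := by rw [dotProduct_smul, hx n hn, smul_zero]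

theorem mem_perp {N : Set Vec3} {x : Vec3} : x ∈ perp N ↔ ∀ n ∈ N, n ⬝ᵥ x = 0 := Iff.rfl

theorem mem_perp_comm {N : Set Vec3} {x : Vec3} (hx : x ∈ perp N) {n : Vec3}
    (hn : n ∈ Submodule.span ℝ N) : n ⬝ᵥ x = 0 := by
  induction hn using Submodule.span_induction with
  | mem n hn => exact hx n hn
  | zero => exact zero_dotProduct x
  | add a b _ _ ha hb => rw [add_dotProduct, ha, hb, add_zero]
  | smul c a _ ha => rw [smul_dotProduct, ha, smul_zero]

theorem finrank_span_add_finrank_perp (N : Set Vec3) :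
    finrank ℝ (Submodule.span ℝ N) + finrank ℝ (perp N) = 3 := by
  have h1 : perp N =
      ((Submodule.span ℝ N).map (dotProductEquiv ℝ (Fin 3)).toLinearMap).dualCoannihilator := by
    ext x
    rw [Submodule.mem_dualCoannihilator]
    constructor
    · rintro hx _ ⟨n, hn, rfl⟩
      exact mem_perp_comm hx hn
    · intro hx n hn
      exact hx _ ⟨n, Submodule.subset_span hn, rfl⟩
  rw [h1, ← LinearEquiv.finrank_map_eq (dotProductEquiv ℝ (Fin 3)) (Submodule.span ℝ N)]
  have := Subspace.finrank_add_finrank_dualCoannihilator_eq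
    ((Submodule.span ℝ N).map (dotProductEquiv ℝ (Fin 3)).toLinearMap)
  simpa using this

theorem finrank_perp_singleton {n : Vec3} (hn : n ≠ 0) : finrank ℝ (perp {n}) = 2 := by
  have := finrank_span_add_finrank_perp {n}
  rw [finrank_span_singleton hn] at this
  omega

theorem exists_pair_span_eq {W : Submodule ℝ Vec3} (hW : finrank ℝ W = 2) :
    ∃ xy : Vec3 × Vec3, LinearIndependent ℝ ![xy.1, xy.2] ∧
      Submodule.span ℝ {xy.1, xy.2} = W := by
  let b := finBasisOfFinrankEq ℝ W hW
  have hli : LinearIndependent ℝ (W.subtype ∘ b) := b.linearIndependent.map' _ (by simp)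
  have h2 : ![(b 0 : Vec3), (b 1 : Vec3)] = W.subtype ∘ b := by
    ext i; fin_cases i <;> rfl
  refine ⟨(b 0, b 1), by rw [h2]; exact hli, ?_⟩
  have h3 : ({(b 0 : Vec3), (b 1 : Vec3)} : Set Vec3) = W.subtype '' Set.range b := by
    rw [← Set.range_comp, ← h2]
    simp [Set.pair_comm]
  rw [h3, Submodule.span_image, b.span_eq, Submodule.map_top, Submodule.range_subtype]

theorem normalVec_ne_zero_and_le {W : Submodule ℝ Vec3} (hW : finrank ℝ W = 2) :
    normalVec W ≠ 0 ∧ W ≤ perp {normalVec W} := by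
  have h := exists_pair_span_eq hW
  have hn : normalVec W = crossProduct h.choose.1 h.choose.2 := by
    rw [normalVec, pluckerVec, dif_pos h, hodgeStar_wedge_eq_cross]
  obtain ⟨hli, hs⟩ := h.choose_spec
  rw [hn]
  refine ⟨crossProduct_ne_zero_iff_linearIndependent.2 hli, ?_⟩
  conv_lhs => rw [← hs]
  rw [Submodule.span_le]
  rintro x hx n rfl
  rw [dotProduct_comm]
  rcases hx with rfl | hx
  · exact dot_self_cross _ _
  · rw [Set.mem_singleton_iff.1 hx]
    exact dot_cross_self _ _

theorem normalVec_ne_zero {W : Submodule ℝ Vec3} (hW : finrank ℝ W = 2) : normalVec W ≠ 0 :=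
  (normalVec_ne_zero_and_le hW).1

theorem perp_normalVec {W : Submodule ℝ Vec3} (hW : finrank ℝ W = 2) :
    perp {normalVec W} = W :=
  (Submodule.eq_of_le_of_finrank_eq (normalVec_ne_zero_and_le hW).2
    (by rw [hW, finrank_perp_singleton (normalVec_ne_zero hW)])).symm

theorem normalVec_dotProduct_eq_zero_iff {W : Submodule ℝ Vec3} (hW : finrank ℝ W = 2) {x : Vec3} :
    normalVec W ⬝ᵥ x = 0 ↔ x ∈ W := by
  conv_rhs => rw [← perp_normalVec hW]
  simp [mem_perp]

/-- Every vector orthogonal to the plane `W` is a multiple of the normal vector. -/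
theorem exists_smul_normalVec_eq {W : Submodule ℝ Vec3} (hW : finrank ℝ W = 2) {y : Vec3}
    (hy : ∀ x ∈ W, y ⬝ᵥ x = 0) : ∃ c : ℝ, c • normalVec W = y := by
  have h1 : finrank ℝ (perp (W : Set Vec3)) = 1 := by
    have := finrank_span_add_finrank_perp (W : Set Vec3)
    rw [Submodule.span_eq, hW] at this
    omega
  have hn : normalVec W ∈ perp (W : Set Vec3) := fun x hx => by
    rw [dotProduct_comm]
    exact (normalVec_dotProduct_eq_zero_iff hW).2 hx
  have hy' : y ∈ perp (W : Set Vec3) := fun x hx => by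
    rw [dotProduct_comm]
    exact hy x hx
  obtain ⟨c, hc⟩ := (finrank_eq_one_iff_of_nonzero' (⟨_, hn⟩ : perp (W : Set Vec3))
    (by simpa [Subtype.ext_iff] using normalVec_ne_zero hW)).1 h1 ⟨y, hy'⟩
  exact ⟨c, congrArg Subtype.val hc⟩

theorem incident_iff {q : ProjPlane} {L : ProjLine} :
    Incident q L ↔ normalVec L.1 ⬝ᵥ q.rep = 0 := by
  rw [dotProduct_comm]
  rfl

/-! ### The rigidity matrix and its rank -/

/-- The functional `m ↦ x ⬝ᵥ m v` on the assignments of vectors to the vertices. -/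
def rowAt {V : Type*} (v : V) : Vec3 →ₗ[ℝ] Dual ℝ (V → Vec3) :=
  (LinearMap.lcomp ℝ ℝ (LinearMap.proj v)).comp (dotProductEquiv ℝ (Fin 3)).toLinearMap

theorem finrank_assignment (V : Type*) [Fintype V] :
    finrank ℝ (V → Vec3) = 3 * Fintype.card V := by
  rw [finrank_pi_fintype]
  simp [mul_comm]

theorem finrank_span_dangling {V : Type*} [Fintype V] (p : V → ProjPlane) :
    finrank ℝ (Submodule.span ℝ (Set.range (RootedGraph.dangling p))) = Fintype.card V := by
  classical
  refine finrank_span_eq_card ?_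
  have := Pi.linearIndependent_single_of_ne_zero (R := ℝ) (v := fun v => (p v).rep)
    fun v => (p v).rep_nonzero
  convert this using 2 with v
  · rw [RootedGraph.dangling]
  · rfl

namespace RootedGraph

variable {V E R : Type*} (G : RootedGraph V E R)

/-- The two ends of an edge in some order. -/
noncomputable def endPair (e : E) : V × V := Quot.out (G.ends e)

theorem ends_eq (e : E) : G.ends e = s((G.endPair e).1, (G.endPair e).2) :=
  (Quot.out_eq (G.ends e)).symm

theorem endPair_ne (e : E) : (G.endPair e).1 ≠ (G.endPair e).2 := by
  have := G.ends_not_isDiag e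
  rwa [G.ends_eq, Sym2.mk_isDiag_iff] at this

/-- The rows of the rigidity matrix, as functionals. -/
noncomputable def rigidityRow (b : E → Ext2) (b₀ : R → Ext2) : E ⊕ R → Dual ℝ (V → Vec3) :=
  Sum.elim
    (fun e => rowAt (G.endPair e).1 (hodgeStar (b e)) - rowAt (G.endPair e).2 (hodgeStar (b e)))
    fun r => rowAt (G.root r) (hodgeStar (b₀ r))

@[simp] theorem rigidityRow_inl (b : E → Ext2) (b₀ : R → Ext2) (e : E) (m : V → Vec3) :
    G.rigidityRow b b₀ (Sum.inl e) m =
      hodgeStar (b e) ⬝ᵥ m (G.endPair e).1 - hodgeStar (b e) ⬝ᵥ m (G.endPair e).2 := rfl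

@[simp] theorem rigidityRow_inr (b : E → Ext2) (b₀ : R → Ext2) (r : R) (m : V → Vec3) :
    G.rigidityRow b b₀ (Sum.inr r) m = hodgeStar (b₀ r) ⬝ᵥ m (G.root r) := rfl

theorem isMotion_iff (b : E → Ext2) (b₀ : R → Ext2) (F : Set E) (S : Set R) (m : V → Vec3) :
    G.IsMotion b b₀ F S m ↔ m ∈ (Submodule.span ℝ
      (G.rigidityRow b b₀ '' (Sum.inl '' F ∪ Sum.inr '' S))).dualCoannihilator := by
  rw [Submodule.mem_dualCoannihilator_span, Set.forall_mem_image]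
  constructor
  · rintro ⟨hE, hR⟩ _ (⟨e, he, rfl⟩ | ⟨r, hr, rfl⟩)
    · rw [rigidityRow_inl, ← dotProduct_sub, dotProduct_comm]
      exact hE e he _ _ (G.ends_eq e)
    · rw [rigidityRow_inr, dotProduct_comm]
      exact hR r hr
  · refine fun h => ⟨fun e he u v huv => ?_, fun r hr => ?_⟩
    · have h1 := h (Or.inl ⟨e, he, rfl⟩)
      rw [rigidityRow_inl] at h1
      rw [pairing, dotProduct_comm, dotProduct_sub]
      rw [G.ends_eq, Sym2.eq_iff] at huv
      rcases huv with ⟨h2, h3⟩ | ⟨h2, h3⟩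
      · rw [← h2, ← h3, h1]
      · rw [← h2, ← h3]
        linarith
    · have h1 := h (Or.inr ⟨r, hr, rfl⟩)
      rwa [rigidityRow_inr, dotProduct_comm] at h1

theorem bar_eq (p : V → ProjPlane) (e : E) : G.bar p e =
    pluckerVec ((p (G.endPair e).1).submodule ⊔ (p (G.endPair e).2).submodule) := by
  rw [bar]
  congr 1
  rw [G.ends_eq e]
  simp [iSup_or, iSup_sup_eq]

theorem _root_.Projectivization.finrank_submodule_sup {q q' : ProjPlane} (h : q ≠ q') :
    finrank ℝ ↥(q.submodule ⊔ q'.submodule) = 2 := by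
  rw [q'.submodule_eq, Submodule.finrank_sup_span_singleton_of_notMem, q.finrank_submodule]
  intro hm
  apply h
  apply Projectivization.submodule_injective
  refine (Submodule.eq_of_le_of_finrank_eq ?_ ?_).symm
  · rwa [q'.submodule_eq, Submodule.span_singleton_le_iff_mem]
  · rw [q.finrank_submodule, q'.finrank_submodule]

theorem hodgeStar_bar (p : V → ProjPlane) (e : E) : hodgeStar (G.bar p e) =
    normalVec ((p (G.endPair e).1).submodule ⊔ (p (G.endPair e).2).submodule) := by
  rw [bar_eq, normalVec]

/-- Each bar and boundary-bar passes through its joints, so its normal vanishes on every multiple of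
them. -/
theorem rigidityRow_dangling {p : V → ProjPlane} {b₀ : R → ProjLine}
    (hp : G.IsBarJointFramework p b₀) (i : E ⊕ R) (m : V → Vec3) (t : V → ℝ)
    (hm : ∀ v, m v = t v • (p v).rep) :
    G.rigidityRow (G.bar p) (fun r => pluckerVec (b₀ r).1) i m = 0 := by
  rcases i with e | r
  · have h2 := Projectivization.finrank_submodule_sup (hp.1.ne (G.endPair_ne e))
    have h3 : ∀ x ∈ ((p (G.endPair e).1).submodule ⊔ (p (G.endPair e).2).submodule),
        hodgeStar (G.bar p e) ⬝ᵥ x = 0 := fun x hx => by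
      rw [hodgeStar_bar, normalVec_dotProduct_eq_zero_iff h2]
      exact hx
    have hrep : ∀ q : ProjPlane, q.rep ∈ q.submodule := fun q => by
      rw [q.submodule_eq]
      exact Submodule.mem_span_singleton_self _
    rw [rigidityRow_inl, h3, h3, sub_zero]
    · rw [hm]
      exact Submodule.smul_mem _ _ (Submodule.mem_sup_right (hrep _))
    · rw [hm]
      exact Submodule.smul_mem _ _ (Submodule.mem_sup_left (hrep _))
  · change normalVec (b₀ r).1 ⬝ᵥ m (G.root r) = 0
    rw [hm, dotProduct_smul, incident_iff.1 (hp.2 r), smul_zero]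

theorem dangling_apply_eq_smul [DecidableEq V] (p : V → ProjPlane) (v u : V) :
    dangling p v u = (if u = v then (1 : ℝ) else 0) • (p u).rep := by
  rw [dangling]
  rcases eq_or_ne u v with rfl | h
  · simp
  · simp [h]

open Classical in
/-- A framework is minimally infinitesimally rigid if and only if its rigidity matrix has
linearly independent rows and the right number of them. -/
theorem isMinInfRigid_iff [Fintype V] [Fintype E] [Fintype R] {p : V → ProjPlane}
    {b₀ : R → ProjLine} (hp : G.IsBarJointFramework p b₀) :
    G.IsMinInfRigid p b₀ ↔
      LinearIndependent ℝ (G.rigidityRow (G.bar p) (fun r => pluckerVec (b₀ r).1)) ∧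
        Fintype.card E + Fintype.card R = 2 * Fintype.card V := by
  set ρ := G.rigidityRow (G.bar p) (fun r => pluckerVec (b₀ r).1)
  set D := Submodule.span ℝ (Set.range (dangling p))
  have hD : finrank ℝ D = Fintype.card V := finrank_span_dangling p
  let M : Set (E ⊕ R) → Submodule ℝ (V → Vec3) := fun I =>
    (Submodule.span ℝ (ρ '' I)).dualCoannihilator
  have hM : ∀ I, finrank ℝ (Submodule.span ℝ (ρ '' I)) + finrank ℝ (M I) =
      3 * Fintype.card V := fun I => by
    rw [Subspace.finrank_add_finrank_dualCoannihilator_eq, finrank_assignment]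
  have hrig : ∀ F S, G.IsInfRigidOn p b₀ F S ↔ M (Sum.inl '' F ∪ Sum.inr '' S) ≤ D :=
    fun F S => forall_congr' fun m => by rw [isMotion_iff]
  have hDM : ∀ I, D ≤ M I := fun I => by
    refine Submodule.span_le.2 ?_
    rintro _ ⟨v, rfl⟩
    rw [SetLike.mem_coe, Submodule.mem_dualCoannihilator_span]
    rintro _ ⟨i, -, rfl⟩
    exact G.rigidityRow_dangling hp i _ _ (dangling_apply_eq_smul p v)
  have huniv : (Sum.inl '' Set.univ ∪ Sum.inr '' Set.univ : Set (E ⊕ R)) = Set.univ := by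
    ext (i | i) <;> simp
  have hl : ∀ e : E, (Sum.inl '' {e}ᶜ ∪ Sum.inr '' Set.univ : Set (E ⊕ R)) = {Sum.inl e}ᶜ := by
    intro e; ext (i | i) <;> simp
  have hr : ∀ r : R, (Sum.inl '' Set.univ ∪ Sum.inr '' {r}ᶜ : Set (E ⊕ R)) = {Sum.inr r}ᶜ := by
    intro e; ext (i | i) <;> simp
  have hmin : G.IsMinInfRigid p b₀ ↔ M Set.univ ≤ D ∧ ∀ i, ¬ M {i}ᶜ ≤ D := by
    rw [IsMinInfRigid, hrig, huniv, Sum.forall]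
    simp only [hrig, hl, hr]
  rw [hmin]
  have hcard : Fintype.card (E ⊕ R) = Fintype.card E + Fintype.card R := Fintype.card_sum
  constructor
  · rintro ⟨h1, h2⟩
    have hli : LinearIndependent ℝ ρ := by
      -- A row in the span of the others could be removed without changing the motions, against
      -- minimality.
      rw [linearIndependent_iff_notMem_span]
      intro i hi
      refine h2 i (le_trans (le_of_eq ?_) h1)
      have : Submodule.span ℝ (ρ '' {i}ᶜ) = Submodule.span ℝ (ρ '' Set.univ) := by
        refine le_antisymm (Submodule.span_mono (Set.image_mono (Set.subset_univ _)))
          (Submodule.span_le.2 ?_)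
        rintro _ ⟨j, -, rfl⟩
        rcases eq_or_ne j i with rfl | hj
        · rwa [← Set.compl_eq_univ_sdiff] at hi
        · exact Submodule.subset_span ⟨j, hj, rfl⟩
      simp only [M, this]
    refine ⟨hli, ?_⟩
    have h3 := hM Set.univ
    rw [le_antisymm h1 (hDM _), hD, Set.image_univ, finrank_span_eq_card hli, hcard] at h3
    omega
  · rintro ⟨hli, hc⟩
    constructor
    · have h3 := hM Set.univ
      rw [Set.image_univ, finrank_span_eq_card hli, hcard] at h3
      exact (Submodule.eq_of_le_of_finrank_eq (hDM _) (by omega)).ge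
    · intro i hi
      have h3 := hM {i}ᶜ
      -- Without row i the rank is at most 2|V| - 1, which leaves more motions than the |V|
      -- dimensions of danglings.
      have h4 : finrank ℝ (Submodule.span ℝ (ρ '' {i}ᶜ)) ≤ Fintype.card (E ⊕ R) - 1 := by
        have h5 := finrank_span_finset_le_card (R := ℝ) ((Finset.univ.erase i).image ρ)
        have h6 := Finset.card_image_le (s := Finset.univ.erase i) (f := ρ)
        rw [Finset.card_erase_of_mem (Finset.mem_univ i), Finset.card_univ] at h6
        have h7 : (((Finset.univ.erase i).image ρ : Finset _) : Set (Dual ℝ (V → Vec3))) =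
            ρ '' {i}ᶜ := by
          simp [Set.compl_eq_univ_sdiff]
        rw [Set.finrank, h7] at h5
        omega
      have h8 := Submodule.finrank_mono hi
      have h9 : 0 < Fintype.card (E ⊕ R) := Fintype.card_pos_iff.2 ⟨i⟩
      omega

/-- Passing from Plücker coordinates to normal vectors does not change dimensions. -/
theorem finrank_span_normalVec (b₀ : R → ProjLine) (S : Set R) :
    finrank ℝ (Submodule.span ℝ ((fun r => normalVec (b₀ r).1) '' S)) =
      finrank ℝ (Submodule.span ℝ ((fun r => pluckerVec (b₀ r).1) '' S)) := by
  have h : (fun r => normalVec (b₀ r).1) '' S =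
      hodgeStarEquiv.toLinearMap '' ((fun r => pluckerVec (b₀ r).1) '' S) := by
    rw [Set.image_image]
    rfl
  rw [h, Submodule.span_image, LinearEquiv.finrank_map_eq]

theorem linearIndependent_normalVec_iff (b₀ : R → ProjLine) (S : Set R) :
    LinearIndependent ℝ (fun r : S => normalVec (b₀ r).1) ↔
      LinearIndependent ℝ (fun r : S => pluckerVec (b₀ r).1) :=
  LinearMap.linearIndependent_iff hodgeStarEquiv.toLinearMap
    (LinearMap.ker_eq_bot.2 hodgeStarEquiv.injective)

/-! ### Necessity of the three conditions -/

theorem linearIndependent_rootsAt {p : V → ProjPlane} {b₀ : R → ProjLine} (hli : LinearIndependent ℝ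
      (G.rigidityRow (G.bar p) (fun r => pluckerVec (b₀ r).1))) (v : V) :
    LinearIndependent ℝ (fun r : G.rootsAt v => pluckerVec (b₀ r).1) := by
  rw [← linearIndependent_normalVec_iff]
  refine LinearIndependent.of_comp (rowAt v) ?_
  have h1 := hli.comp (fun r : G.rootsAt v => Sum.inr r.1)
    (Sum.inr_injective.comp Subtype.val_injective)
  convert h1 using 1
  ext r : 1
  have hr : G.root r.1 = v := r.2
  simp only [Function.comp, rigidityRow, Sum.elim_inr, hr]
  rfl

/-- The independent normals at v all lie in the plane orthogonal to the joint. -/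
theorem ncard_rootsAt_le_two [Fintype R] {p : V → ProjPlane}
    {b₀ : R → ProjLine} (hp : G.IsBarJointFramework p b₀) (v : V)
    (hv : LinearIndependent ℝ (fun r : G.rootsAt v => pluckerVec (b₀ r).1)) :
    (G.rootsAt v).ncard ≤ 2 := by
  classical
  rw [← linearIndependent_normalVec_iff] at hv
  have h1 := finrank_span_eq_card hv
  rw [← Nat.card_coe_set_eq, Nat.card_eq_fintype_card, ← h1]
  refine le_trans ?_ (finrank_perp_singleton (p v).rep_nonzero).le
  refine Submodule.finrank_mono (Submodule.span_le.2 ?_)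
  rintro _ ⟨r, rfl⟩ _ rfl
  have hr : G.root r.1 = v := r.2
  have h2 := incident_iff.1 (hp.2 r.1)
  rw [hr] at h2
  rwa [dotProduct_comm]

/-- The rows of F and R_F are independent, so their common kernel has dimension 3|V| - |F| - |R_F|.
It contains an explicit space of dimension |X| + dim C + 3(|V| - |X|), where X = V(F) and C is the
space orthogonal to the normals of R_F. -/
theorem ncard_add_ncard_rootsOf_le [Fintype V] [Fintype E] [Fintype R] {p : V → ProjPlane}
    {b₀ : R → ProjLine} (hp : G.IsBarJointFramework p b₀)
    (hli : LinearIndependent ℝ (G.rigidityRow (G.bar p) (fun r => pluckerVec (b₀ r).1)))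
    {F : Set E} (hF : F.Nonempty) :
    (F.ncard : ℤ) + (G.rootsOf F).ncard ≤ 2 * (G.vertsOf F).ncard - 3 +
      finrank ℝ (Submodule.span ℝ ((fun r => pluckerVec (b₀ r).1) '' G.rootsOf F)) := by
  classical
  set ρ := G.rigidityRow (G.bar p) (fun r => pluckerVec (b₀ r).1)
  set X := G.vertsOf F
  set C := perp ((fun r => normalVec (b₀ r).1) '' G.rootsOf F)
  have hC : finrank ℝ (Submodule.span ℝ ((fun r => pluckerVec (b₀ r).1) '' G.rootsOf F)) +
      finrank ℝ C = 3 := by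
    rw [← finrank_span_normalVec, finrank_span_add_finrank_perp]
  let I : Set (E ⊕ R) := Sum.inl '' F ∪ Sum.inr '' G.rootsOf F
  have hI : I.ncard = F.ncard + (G.rootsOf F).ncard := by
    rw [Set.ncard_union_eq, Set.ncard_image_of_injective _ Sum.inl_injective,
      Set.ncard_image_of_injective _ Sum.inr_injective]
    rw [Set.disjoint_left]
    rintro _ ⟨e, -, rfl⟩ ⟨r, -, h⟩
    simp at h
  have hspan : finrank ℝ (Submodule.span ℝ (ρ '' I)) = I.ncard := by
    have h1 := finrank_span_eq_card (hli.comp (Subtype.val : I → E ⊕ R) Subtype.val_injective)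
    rw [Set.range_comp, Subtype.range_coe] at h1
    rw [h1, ← Nat.card_coe_set_eq, Nat.card_eq_fintype_card]
  -- On X a dangling plus one common vector of C; outside X, where no row of F or R_F acts,
  -- anything.
  let Φ : ((X → ℝ) × C × ((Xᶜ : Set V) → Vec3)) →ₗ[ℝ] (V → Vec3) :=
    { toFun := fun z v => if h : v ∈ X then z.1 ⟨v, h⟩ • (p v).rep + z.2.1 else z.2.2 ⟨v, h⟩
      map_add' := fun y z => by
        ext1 v
        by_cases h : v ∈ X
        · simp only [h, dif_pos, Pi.add_apply, Prod.fst_add, Prod.snd_add, Submodule.coe_add]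
          module
        · simp [h]
      map_smul' := fun c z => by
        ext1 v
        by_cases h : v ∈ X
        · simp only [h, dif_pos, Pi.smul_apply, Prod.smul_fst, Prod.smul_snd, Submodule.coe_smul,
            RingHom.id_apply, smul_eq_mul]
          module
        · simp [h] }
  have hΦ : ∀ z v (h : v ∈ X), Φ z v = z.1 ⟨v, h⟩ • (p v).rep + z.2.1 := fun z v h => dif_pos h
  have hΦ' : ∀ z v (h : v ∉ X), Φ z v = z.2.2 ⟨v, h⟩ := fun z v h => dif_neg h
  obtain ⟨e, he⟩ := hF
  have hfst : ∀ e ∈ F, (G.endPair e).1 ∈ X := fun e he => ⟨e, he, by rw [ends_eq]; simp⟩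
  have hsnd : ∀ e ∈ F, (G.endPair e).2 ∈ X := fun e he => ⟨e, he, by rw [ends_eq]; simp⟩
  have hinj : Function.Injective Φ := by
    rw [← LinearMap.ker_eq_bot, LinearMap.ker_eq_bot']
    intro z hz
    have hz1 : ∀ v (h : v ∈ X), z.1 ⟨v, h⟩ • (p v).rep = -(z.2.1 : Vec3) := fun v h => by
      rw [eq_neg_iff_add_eq_zero, ← hΦ, hz]
      rfl
    have hc : (z.2.1 : Vec3) = 0 := by
      have hu := hz1 _ (hfst e he)
      have hw := hz1 _ (hsnd e he)
      -- A nonzero common vector would be a multiple of both end joints of e, making these two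
      -- distinct points equal.
      by_contra hc
      have ht : z.1 ⟨_, hsnd e he⟩ ≠ 0 := fun ht => hc (by
        rw [ht, zero_smul] at hw
        simpa using hw.symm)
      apply hp.1.ne (G.endPair_ne e)
      rw [← (p (G.endPair e).1).mk_rep, ← (p (G.endPair e).2).mk_rep,
        Projectivization.mk_eq_mk_iff']
      have hs : z.1 ⟨_, hfst e he⟩ ≠ 0 := fun ht => hc (by
        rw [ht, zero_smul] at hu
        simpa using hu.symm)
      refine ⟨(z.1 ⟨_, hfst e he⟩)⁻¹ * z.1 ⟨_, hsnd e he⟩, ?_⟩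
      rw [mul_smul, hw, ← hu, smul_smul, inv_mul_cancel₀ hs, one_smul]
    have ht : z.1 = 0 := by
      ext ⟨v, hv⟩
      have := hz1 v hv
      rw [hc, neg_zero, smul_eq_zero, or_iff_left (p v).rep_nonzero] at this
      exact this
    have hw : z.2.2 = 0 := by
      ext1 ⟨v, hv⟩
      rw [← hΦ' z v hv, hz]
      rfl
    exact Prod.ext ht (Prod.ext (Subtype.ext hc) hw)
  have hrange : LinearMap.range Φ ≤ (Submodule.span ℝ (ρ '' I)).dualCoannihilator := by
    rintro _ ⟨z, rfl⟩
    rw [Submodule.mem_dualCoannihilator_span]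
    have hrow : ∀ i, ρ i (fun v => (if h : v ∈ X then z.1 ⟨v, h⟩ else 0) • (p v).rep) = 0 :=
      fun i => G.rigidityRow_dangling hp i _ _ fun v => rfl
    rintro _ ⟨i, ⟨e, he, rfl⟩ | ⟨r, hr, rfl⟩, rfl⟩
    · have h1 := hrow (Sum.inl e)
      rw [rigidityRow_inl, dif_pos (hfst e he), dif_pos (hsnd e he)] at h1
      rw [rigidityRow_inl, hΦ _ _ (hfst e he), hΦ _ _ (hsnd e he), dotProduct_add, dotProduct_add]
      linarith
    · have h1 := hrow (Sum.inr r)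
      rw [rigidityRow_inr, dif_pos (show G.root r ∈ X from hr)] at h1
      rw [rigidityRow_inr, hΦ _ _ hr, dotProduct_add, h1, zero_add]
      exact z.2.1.2 _ ⟨r, hr, rfl⟩
  have h1 := Submodule.finrank_mono hrange
  rw [LinearMap.finrank_range_of_inj hinj, finrank_prod, finrank_prod, finrank_assignment,
    finrank_fintype_fun_eq_card] at h1
  have h2 := Subspace.finrank_add_finrank_dualCoannihilator_eq (Submodule.span ℝ (ρ '' I))
  rw [hspan, hI, finrank_assignment] at h2
  have h3 := Set.ncard_add_ncard_compl X
  rw [← Nat.card_coe_set_eq X, ← Nat.card_coe_set_eq Xᶜ, Nat.card_eq_fintype_card,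
    Nat.card_eq_fintype_card, Nat.card_eq_fintype_card] at h3
  rw [← Nat.card_coe_set_eq X, Nat.card_eq_fintype_card]
  omega

end RootedGraph

/-! ### The sparsity count on arbitrary vertex sets -/

theorem sum_ncard_fiber {α β : Type*} [Finite α] [Fintype β] (D : Set α) (f : α → β) :
    ∑ b, {a | a ∈ D ∧ f a = b}.ncard = D.ncard := by
  classical
  have := Fintype.ofFinite α
  rw [Set.ncard_eq_toFinset_card', Finset.card_eq_sum_card_fiberwise
    (f := f) (t := Finset.univ) (fun _ _ => Finset.mem_coe.2 (Finset.mem_univ _))]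
  refine Finset.sum_congr rfl fun b _ => ?_
  rw [Set.ncard_eq_toFinset_card']
  congr 1
  ext a
  simp

namespace RootedGraph

variable {V E R : Type*} (G : RootedGraph V E R)

/-- The number of edges that a minimally rigid framework with bar-boundary may have on a set of
vertices, where the boundary-bars have the normal vectors `n`. -/
noncomputable def maxEdges (n : R → Vec3) (X : Set V) : ℤ :=
  2 * X.ncard - (G.root ⁻¹' X).ncard - 3 + finrank ℝ (Submodule.span ℝ (n '' (G.root ⁻¹' X)))

theorem ncard_preimage_root_le [Finite V] [Finite R] (h2 : ∀ v, (G.rootsAt v).ncard ≤ 2)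
    (X : Set V) : (G.root ⁻¹' X).ncard ≤ 2 * X.ncard := by
  classical
  have := Fintype.ofFinite V
  have := Fintype.ofFinite R
  rw [Set.ncard_eq_toFinset_card', Set.ncard_eq_toFinset_card']
  refine Finset.card_le_mul_card_image_of_maps_to (f := G.root) (fun r hr => by simpa using hr) 2
    fun v _ => le_trans ?_ (h2 v)
  rw [Set.ncard_eq_toFinset_card']
  exact Finset.card_le_card fun r hr => Set.mem_toFinset.2 (Finset.mem_filter.1 hr).2

/-- Each added vertex contributes 2 and brings at most two roots, while the rank cannot drop. -/
theorem maxEdges_mono [Finite V] [Finite R] (h2 : ∀ v, (G.rootsAt v).ncard ≤ 2) (n : R → Vec3)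
    {X Y : Set V} (h : X ⊆ Y) : G.maxEdges n X ≤ G.maxEdges n Y := by
  have h3 := G.ncard_preimage_root_le h2 (Y \ X)
  have h4 := Set.ncard_sdiff_add_ncard_of_subset h
  have h5 := Set.ncard_sdiff_add_ncard_of_subset (Set.preimage_mono (f := G.root) h)
  rw [Set.preimage_sdiff] at h3
  have h6 : finrank ℝ (Submodule.span ℝ (n '' (G.root ⁻¹' X))) ≤
      finrank ℝ (Submodule.span ℝ (n '' (G.root ⁻¹' Y))) :=
    Submodule.finrank_mono (Submodule.span_mono (Set.image_mono (Set.preimage_mono h)))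
  rw [maxEdges, maxEdges]
  omega

theorem finrank_span_rootsAt [Finite R] {n : R → Vec3} {v : V}
    (hli : LinearIndependent ℝ fun r : G.rootsAt v => n r) :
    finrank ℝ (Submodule.span ℝ (n '' (G.rootsAt v))) = (G.rootsAt v).ncard := by
  classical
  have := Fintype.ofFinite R
  have h1 := finrank_span_eq_card hli
  rw [← Set.image_eq_range] at h1
  rw [h1, ← Nat.card_coe_set_eq, Nat.card_eq_fintype_card]

/-- Two vertices with two roots each have three linearly independent boundary lines. -/
theorem three_le_finrank_span_pair [Finite R] {b₀ : R → ProjLine}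
    (hgen : InGeneralPosition (Set.range b₀))
    (hsep : ∀ r r' s s' : R, G.root r = G.root r' → G.root s = G.root s' →
      b₀ r ≠ b₀ r' → b₀ s = b₀ r → b₀ s' = b₀ r' → G.root s = G.root r)
    (hli : ∀ v, LinearIndependent ℝ fun r : G.rootsAt v => normalVec (b₀ r).1)
    {u v : V} (huv : u ≠ v) (hu : (G.rootsAt u).ncard = 2) (hv : (G.rootsAt v).ncard = 2) :
    3 ≤ finrank ℝ (Submodule.span ℝ
      ((fun r => normalVec (b₀ r).1) '' (G.root ⁻¹' {u, v}))) := by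
  set N := (fun r => normalVec (b₀ r).1) '' (G.root ⁻¹' {u, v})
  by_contra hlt
  have hN := finrank_span_add_finrank_perp N
  -- Rank at most two leaves a vector orthogonal to all the normals, that is, a point common to all
  -- these lines.
  obtain ⟨⟨q, hq⟩, hq0⟩ := (finrank_pos_iff_exists_ne_zero (R := ℝ) (M := perp N)).1 (by omega)
  have hq0 : q ≠ 0 := fun h => hq0 (Subtype.ext h)
  have hinc : ∀ r, G.root r = u ∨ G.root r = v → Incident (Projectivization.mk ℝ q hq0) (b₀ r) := by
    intro r hr
    rw [incident_iff]
    obtain ⟨a, ha⟩ := Projectivization.exists_smul_eq_mk_rep ℝ q hq0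
    rw [← ha, Units.smul_def, dotProduct_smul, hq _ ⟨r, hr, rfl⟩, smul_zero]
  have hne : ∀ w : V, ∀ r r' : R, G.root r = w → G.root r' = w → r ≠ r' → b₀ r ≠ b₀ r' := by
    intro w r r' hr hr' hrr h
    have := (hli w).injective (a₁ := ⟨r, hr⟩) (a₂ := ⟨r', hr'⟩) (by simp [h])
    exact hrr (congrArg Subtype.val this)
  obtain ⟨r, r', hrr, hR⟩ := Set.ncard_eq_two.1 hu
  obtain ⟨s, s', hss, hS⟩ := Set.ncard_eq_two.1 hv
  have hr : G.root r = u := by change r ∈ G.rootsAt u; simp [hR]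
  have hr' : G.root r' = u := by change r' ∈ G.rootsAt u; simp [hR]
  have hs : G.root s = v := by change s ∈ G.rootsAt v; simp [hS]
  have hs' : G.root s' = v := by change s' ∈ G.rootsAt v; simp [hS]
  have hbr := hne u r r' hr hr' hrr
  have hbs := hne v s s' hs hs' hss
  -- A third line through the common point would violate general position, so v carries the same
  -- pair of lines as u.
  have hmem : ∀ t, G.root t = v → b₀ t = b₀ r ∨ b₀ t = b₀ r' := by
    intro t ht
    by_contra! hc
    exact hgen _ ⟨r, rfl⟩ _ ⟨r', rfl⟩ _ ⟨t, rfl⟩ hbr hc.1.symm hc.2.symm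
      ⟨_, hinc r (.inl hr), hinc r' (.inl hr'), hinc t (.inr ht)⟩
  have hvu : G.root s ≠ G.root r := by rw [hs, hr]; exact huv.symm
  have hvu' : G.root s' ≠ G.root r := by rw [hs', hr]; exact huv.symm
  rcases hmem s hs with h1 | h1 <;> rcases hmem s' hs' with h2 | h2
  · exact hbs (h1.trans h2.symm)
  · exact hvu (hsep r r' s s' (hr.trans hr'.symm) (hs.trans hs'.symm) hbr h1 h2)
  · exact hvu' (hsep r r' s' s (hr.trans hr'.symm) (hs'.trans hs.symm) hbr h2 h1)
  · exact hbs (h1.trans h2.symm)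

/-- By monotonicity a pair {u, v} suffices, where the value is 1 - |R_u| - |R_v| plus the rank.
Independence at each vertex suffices unless both have two roots; then rank three is needed, and this
is where the hypotheses on the lines enter. -/
theorem maxEdges_nonneg [Finite V] [Finite R] {b₀ : R → ProjLine}
    (hgen : InGeneralPosition (Set.range b₀))
    (hsep : ∀ r r' s s' : R, G.root r = G.root r' → G.root s = G.root s' →
      b₀ r ≠ b₀ r' → b₀ s = b₀ r → b₀ s' = b₀ r' → G.root s = G.root r)
    (h2 : ∀ v, (G.rootsAt v).ncard ≤ 2)
    (hli : ∀ v, LinearIndependent ℝ fun r : G.rootsAt v => normalVec (b₀ r).1)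
    {X : Set V} (hX : X.Nontrivial) : 0 ≤ G.maxEdges (fun r => normalVec (b₀ r).1) X := by
  obtain ⟨u, hu, v, hv, huv⟩ := hX
  refine le_trans ?_ (G.maxEdges_mono h2 _ (Set.insert_subset hu (Set.singleton_subset_iff.2 hv)))
  have hun : G.root ⁻¹' {u, v} = G.rootsAt u ∪ G.rootsAt v := by
    ext r; simp [rootsAt]
  have hd : Disjoint (G.rootsAt u) (G.rootsAt v) :=
    Set.disjoint_left.2 fun r (hr : G.root r = u) (hr' : G.root r = v) => huv (hr.symm.trans hr')
  have hcard : (G.root ⁻¹' {u, v}).ncard = (G.rootsAt u).ncard + (G.rootsAt v).ncard := by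
    rw [hun, Set.ncard_union_eq hd]
  have hle : ∀ w ∈ ({u, v} : Set V), (G.rootsAt w).ncard ≤ finrank ℝ (Submodule.span ℝ
      ((fun r => normalVec (b₀ r).1) '' (G.root ⁻¹' {u, v}))) := fun w hw => by
    rw [← G.finrank_span_rootsAt (n := fun r => normalVec (b₀ r).1) (hli w)]
    refine Submodule.finrank_mono (Submodule.span_mono (Set.image_mono ?_))
    intro r hr
    rw [Set.mem_preimage, show G.root r = w from hr]
    exact hw
  have hlu := hle u (by simp)
  have hlv := hle v (by simp)
  have h3 := G.three_le_finrank_span_pair hgen hsep hli huv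
  have h4 := h2 u
  have h5 := h2 v
  rw [maxEdges, hcard, Set.ncard_pair huv]
  omega

/-- Carries condition 2 from V(F) to any larger set of vertices, and includes the empty edge set,
about which condition 2 is silent. -/
theorem ncard_le_maxEdges [Finite V] [Finite R] {b₀ : R → ProjLine}
    (hgen : InGeneralPosition (Set.range b₀))
    (hsep : ∀ r r' s s' : R, G.root r = G.root r' → G.root s = G.root s' →
      b₀ r ≠ b₀ r' → b₀ s = b₀ r → b₀ s' = b₀ r' → G.root s = G.root r)
    (h2 : ∀ v, (G.rootsAt v).ncard ≤ 2)
    (hli : ∀ v, LinearIndependent ℝ fun r : G.rootsAt v => normalVec (b₀ r).1)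
    (hF : ∀ F : Set E, F.Nonempty →
      (F.ncard : ℤ) + (G.rootsOf F).ncard ≤ 2 * (G.vertsOf F).ncard - 3 +
        finrank ℝ (Submodule.span ℝ ((fun r => pluckerVec (b₀ r).1) '' G.rootsOf F)))
    {X : Set V} (hX : X.Nontrivial) {F : Set E} (hFX : G.vertsOf F ⊆ X) :
    (F.ncard : ℤ) ≤ G.maxEdges (fun r => normalVec (b₀ r).1) X := by
  rcases F.eq_empty_or_nonempty with rfl | hne
  · simpa using G.maxEdges_nonneg hgen hsep h2 hli hX
  · refine le_trans ?_ (G.maxEdges_mono h2 _ hFX)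
    have h3 := hF F hne
    rw [← finrank_span_normalVec] at h3
    change _ ≤ 2 * ((G.vertsOf F).ncard : ℤ) - (G.rootsOf F).ncard - 3 +
      finrank ℝ (Submodule.span ℝ ((fun r => normalVec (b₀ r).1) '' G.rootsOf F))
    omega

end RootedGraph

/-! ### Dimension count over the classes of an equivalence relation -/

/-- Dimension bound for a space of assignments of vectors to vertices that are constant on the
classes of `s`, take a constant value under `φ`, and are orthogonal to prescribed vectors. -/
theorem finrank_le_sum_finrank_perp {V R : Type*} [Fintype V] (root : R → V) (n : R → Vec3)
    (φ : Vec3) (v₀ : V) (s : Setoid V) [Fintype (Quotient s)] (M : Submodule ℝ (V → Vec3))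
    (hconst : ∀ m ∈ M, ∀ u v, s u v → m u = m v)
    (hφ : ∀ m ∈ M, ∀ v, φ ⬝ᵥ m v = φ ⬝ᵥ m v₀)
    (hn : ∀ m ∈ M, ∀ r, n r ⬝ᵥ m (root r) = 0) (δ : ℕ)
    (hδ : δ = 0 → ∀ m ∈ M, φ ⬝ᵥ m v₀ = 0) :
    finrank ℝ M ≤
      ∑ C : Quotient s, finrank ℝ (perp (insert φ (n '' {r | Quotient.mk s (root r) = C}))) + δ := by
  let κ : M →ₗ[ℝ] ℝ := (rowAt v₀ φ).comp M.subtype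
  have hout : ∀ v, s (Quotient.mk s v).out v := fun v => Quotient.mk_out v
  -- An assignment of level zero is determined by one vector per class, orthogonal to φ and to all
  -- normals of the class. The level itself costs at most δ.
  let Ψ : LinearMap.ker κ →ₗ[ℝ]
      ∀ C : Quotient s, perp (insert φ (n '' {r | Quotient.mk s (root r) = C})) :=
    LinearMap.pi fun C => LinearMap.codRestrict _
      ((LinearMap.proj C.out).comp (M.subtype.comp (LinearMap.ker κ).subtype)) fun m => by
        rintro _ (rfl | ⟨r, rfl, rfl⟩)
        · exact (hφ m.1.1 m.1.2 _).trans m.2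
        · exact (congrArg _ (hconst m.1.1 m.1.2 _ _ (hout (root r)))).trans (hn m.1.1 m.1.2 r)
  have hΨ : Function.Injective Ψ := by
    intro m m' hm
    ext1
    ext1
    funext v
    have h1 := congrArg Subtype.val (congrFun hm (Quotient.mk s v))
    exact (hconst m.1.1 m.1.2 _ _ (hout v)).symm.trans
      (h1.trans (hconst m'.1.1 m'.1.2 _ _ (hout v)))
  have h1 := LinearMap.finrank_le_finrank_of_injective hΨ
  rw [finrank_pi_fintype] at h1
  have h2 := κ.finrank_range_add_finrank_ker
  have h3 : finrank ℝ (LinearMap.range κ) ≤ δ := by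
    rcases Nat.eq_zero_or_pos δ with h | h
    · have : κ = 0 := LinearMap.ext fun m => hδ h m.1 m.2
      rw [this, LinearMap.range_zero, finrank_bot]
      exact Nat.zero_le _
    · have := Submodule.finrank_le (LinearMap.range κ)
      rw [finrank_self] at this
      omega
  omega

open Classical in
theorem finrank_perp_insert (φ : Vec3) (N : Set Vec3) :
    finrank ℝ (perp (insert φ N)) + finrank ℝ (Submodule.span ℝ N) +
      (if φ ∈ Submodule.span ℝ N then 0 else 1) = 3 := by
  have h1 := finrank_span_add_finrank_perp (insert φ N)
  rw [Submodule.span_insert, sup_comm] at h1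
  split_ifs with h
  · rw [sup_eq_left.2 ((Submodule.span_singleton_le_iff_mem _ _).2 h)] at h1
    omega
  · rw [Submodule.finrank_sup_span_singleton_of_notMem h] at h1
    omega

namespace RootedGraph

variable {V E R : Type*} (G : RootedGraph V E R)

/-- For at least two vertices, the -3 + rank in the count cancels against dim perp = 3 - rank - [φ
outside the span], which leaves one unit of slack when φ is outside. For a single vertex there are
no edges and φ is outside the span, so equality holds with no slack left. -/
theorem ncard_add_finrank_perp_le [Fintype V] [Finite E] [Finite R] (n : R → Vec3) (φ : Vec3)
    (hli : ∀ v, LinearIndependent ℝ fun r : G.rootsAt v => n r)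
    (hφv : ∀ v, φ ∉ Submodule.span ℝ (n '' G.rootsAt v))
    (hcount : ∀ X : Set V, X.Nontrivial → ∀ F : Set E, G.vertsOf F ⊆ X →
      (F.ncard : ℤ) ≤ G.maxEdges n X)
    {X : Set V} (hX : X.Nonempty) {F : Set E} (hFX : G.vertsOf F ⊆ X) {δ : ℕ} (hδ1 : δ ≤ 1)
    (hδ : δ ≠ 0 → X.Nontrivial ∧ φ ∉ Submodule.span ℝ (n '' (G.root ⁻¹' X))) :
    F.ncard + finrank ℝ (perp (insert φ (n '' (G.root ⁻¹' X)))) + (G.root ⁻¹' X).ncard + δ ≤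
      2 * X.ncard := by
  classical
  have h1 := finrank_perp_insert φ (n '' (G.root ⁻¹' X))
  by_cases hXn : X.Nontrivial
  · have h2 := hcount X hXn F hFX
    rw [maxEdges] at h2
    rcases eq_or_ne δ 0 with h0 | h0
    · omega
    · rw [if_neg (hδ h0).2] at h1
      omega
  · obtain ⟨v, rfl⟩ : ∃ v, X = {v} := by
      obtain ⟨v, hv⟩ := hX
      exact ⟨v, (Set.not_nontrivial_iff.1 hXn).eq_singleton_of_mem hv⟩
    have hF : F = ∅ := by
      rw [Set.eq_empty_iff_forall_notMem]
      intro e he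
      apply G.endPair_ne e
      have ha := hFX ⟨e, he, show (G.endPair e).1 ∈ G.ends e by rw [ends_eq]; simp⟩
      have hb := hFX ⟨e, he, show (G.endPair e).2 ∈ G.ends e by rw [ends_eq]; simp⟩
      exact ha.trans hb.symm
    have hpre : G.root ⁻¹' {v} = G.rootsAt v := rfl
    have h0 : δ = 0 := by
      by_contra h0
      exact hXn (hδ h0).1
    rw [hpre, if_neg (hφv v), G.finrank_span_rootsAt (hli v)] at h1
    rw [hF, Set.ncard_empty, Set.ncard_singleton, hpre, h0]
    omega

/-- The dimension bound summed over the classes of an equivalence relation on the vertices. -/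
theorem finrank_add_ncard_le [Fintype V] [Finite E] [Finite R] (n : R → Vec3) (φ : Vec3)
    (v₀ : V) (hli : ∀ v, LinearIndependent ℝ fun r : G.rootsAt v => n r)
    (hφv : ∀ v, φ ∉ Submodule.span ℝ (n '' G.rootsAt v))
    (hcount : ∀ X : Set V, X.Nontrivial → ∀ F : Set E, G.vertsOf F ⊆ X →
      (F.ncard : ℤ) ≤ G.maxEdges n X)
    (s : Setoid V) (M : Submodule ℝ (V → Vec3))
    (hconst : ∀ m ∈ M, ∀ u v, s u v → m u = m v)
    (hφ : ∀ m ∈ M, ∀ v, φ ⬝ᵥ m v = φ ⬝ᵥ m v₀)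
    (hn : ∀ m ∈ M, ∀ r, n r ⬝ᵥ m (G.root r) = 0)
    (F : Set E) (hF : ∀ e ∈ F, s (G.endPair e).1 (G.endPair e).2) (ε : ℕ)
    (hε : ε = 0 → (∃ m ∈ M, φ ⬝ᵥ m v₀ ≠ 0) → ∃ u v, u ≠ v ∧ s u v) :
    finrank ℝ M + F.ncard + Nat.card R ≤ 2 * Nat.card V + ε := by
  classical
  have := Fintype.ofFinite R
  let cls : Quotient s → Set V := fun C => {v | Quotient.mk s v = C}
  have hcls : ∀ C, (cls C).Nonempty := fun C => ⟨C.out, Quotient.out_eq C⟩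
  let part : Quotient s → Set E := fun C => {e | e ∈ F ∧ Quotient.mk s (G.endPair e).1 = C}
  have hpart : ∀ C, G.vertsOf (part C) ⊆ cls C := by
    rintro C v ⟨e, ⟨heF, heC⟩, hv⟩
    rw [ends_eq, Sym2.mem_iff] at hv
    rcases hv with rfl | rfl
    · exact heC
    · exact (Quotient.sound (s.symm (hF e heF))).trans heC
  have hV : ∑ C, (cls C).ncard = Nat.card V := by
    have := sum_ncard_fiber (Set.univ : Set V) (Quotient.mk s)
    simpa [cls] using this
  have hR : ∑ C, (G.root ⁻¹' (cls C)).ncard = Nat.card R := by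
    have := sum_ncard_fiber (Set.univ : Set R) (fun r => Quotient.mk s (G.root r))
    simpa [cls] using this
  have hE : ∑ C, (part C).ncard = F.ncard :=
    sum_ncard_fiber F (fun e => Quotient.mk s (G.endPair e).1)
  have hmain := finrank_le_sum_finrank_perp G.root n φ v₀ s M hconst hφ hn
  change ∀ δ : ℕ, _ → _ ≤ ∑ C, finrank ℝ (perp (insert φ (n '' (G.root ⁻¹' (cls C))))) + δ at hmain
  by_cases hκ : ∃ m ∈ M, φ ⬝ᵥ m v₀ ≠ 0
  -- A nonzero level costs one dimension. For ε = 0 the slack of a nontrivial class pays for it: an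
  -- m of nonzero level there is orthogonal to the normals of the class, so φ is not in their span.
  · obtain ⟨C₀, hC₀⟩ : ∃ C₀ : Quotient s, ε = 0 → (cls C₀).Nontrivial ∧
        φ ∉ Submodule.span ℝ (n '' (G.root ⁻¹' (cls C₀))) := by
      rcases Nat.eq_zero_or_pos ε with h0 | h0
      · obtain ⟨u, v, huv, hs⟩ := hε h0 hκ
        refine ⟨Quotient.mk s u, fun _ => ⟨⟨u, rfl, v, (Quotient.sound hs).symm, huv⟩, ?_⟩⟩
        obtain ⟨m, hm, hm0⟩ := hκ
        intro hspan
        apply hm0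
        rw [← hφ m hm u]
        refine mem_perp_comm (N := n '' (G.root ⁻¹' (cls (Quotient.mk s u)))) ?_ hspan
        rintro _ ⟨r, hr, rfl⟩
        rw [← hconst m hm _ _ (Quotient.exact hr)]
        exact hn m hm r
      · exact ⟨Quotient.mk s v₀, fun h => absurd h h0.ne'⟩
    have h1 := hmain 1 (fun h => absurd h one_ne_zero)
    have h2 : ∀ C, (part C).ncard + finrank ℝ (perp (insert φ (n '' (G.root ⁻¹' (cls C))))) +
        (G.root ⁻¹' (cls C)).ncard + (if C = C₀ then (if ε = 0 then 1 else 0) else 0) ≤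
        2 * (cls C).ncard := fun C =>
      G.ncard_add_finrank_perp_le n φ hli hφv hcount (hcls C) (hpart C)
        (by split_ifs <;> simp) (by
          intro h
          split_ifs at h with h3 h4
          · subst h3
            exact hC₀ h4
          all_goals exact absurd rfl h)
    have h3 := Finset.sum_le_sum fun C (_ : C ∈ Finset.univ) => h2 C
    rw [Finset.sum_add_distrib, Finset.sum_add_distrib, Finset.sum_add_distrib, hE, hR,
      ← Finset.mul_sum, hV, Finset.sum_ite_eq' Finset.univ C₀, if_pos (Finset.mem_univ _)] at h3
    split_ifs at h3 <;> omega
  · push Not at hκ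
    have h1 := hmain 0 (fun _ => hκ)
    have h2 : ∀ C, (part C).ncard + finrank ℝ (perp (insert φ (n '' (G.root ⁻¹' (cls C))))) +
        (G.root ⁻¹' (cls C)).ncard + 0 ≤ 2 * (cls C).ncard := fun C =>
      G.ncard_add_finrank_perp_le n φ hli hφv hcount (hcls C) (hpart C) zero_le_one
        (fun h => absurd rfl h)
    have h3 := Finset.sum_le_sum fun C (_ : C ∈ Finset.univ) => h2 C
    rw [Finset.sum_add_distrib, Finset.sum_add_distrib, Finset.sum_add_distrib, hE, hR,
      ← Finset.mul_sum, hV] at h3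
    simp only [Finset.sum_const_zero] at h3
    omega

end RootedGraph

/-! ### Flats of functionals and the generic placement -/

/-- A proper subspace of the dual space of codimension at most one is the annihilator of a
vector. -/
theorem Submodule.exists_forall_mem_iff_apply_eq_zero {K W : Type*} [Field K] [AddCommGroup W]
    [Module K W] [FiniteDimensional K W] {T : Submodule K (Dual K W)} (hT : T ≠ ⊤)
    (hdim : finrank K W ≤ finrank K T + 1) : ∃ q : W, ∀ φ : Dual K W, φ ∈ T ↔ φ q = 0 := by
  have h1 := Subspace.finrank_add_finrank_dualCoannihilator_eq T
  have h2 := Submodule.finrank_lt hT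
  rw [Subspace.dual_finrank_eq] at h2
  obtain ⟨⟨q, hq⟩, hq0⟩ :=
    (finrank_pos_iff_exists_ne_zero (R := K) (M := T.dualCoannihilator)).1 (by omega)
  have hq0 : q ≠ 0 := fun h => hq0 (Subtype.ext h)
  have hle : T ≤ (K ∙ q).dualAnnihilator := fun φ hφ => by
    rw [Submodule.mem_dualAnnihilator]
    intro w hw
    obtain ⟨c, rfl⟩ := Submodule.mem_span_singleton.1 hw
    rw [map_smul, (Submodule.mem_dualCoannihilator q).1 hq φ hφ, smul_zero]
  have h3 := Subspace.finrank_add_finrank_dualAnnihilator_eq (K ∙ q)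
  rw [finrank_span_singleton hq0] at h3
  have heq := Submodule.eq_of_le_of_finrank_le hle (by omega)
  refine ⟨q, fun φ => ?_⟩
  rw [heq, Submodule.mem_dualAnnihilator]
  refine ⟨fun h => h q (Submodule.mem_span_singleton_self q), fun h w hw => ?_⟩
  obtain ⟨c, rfl⟩ := Submodule.mem_span_singleton.1 hw
  rw [map_smul, h, smul_zero]

section Flats

variable {V : Type*}

/-- The functionals that compare the vectors at two vertices. -/
def flat (z : V × V) : Submodule ℝ (Dual ℝ (V → Vec3)) := LinearMap.range (rowAt z.1 - rowAt z.2)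

theorem apply_eq_of_flat {z : V × V} {m : V → Vec3} (h : ∀ f ∈ flat z, f m = 0) :
    m z.1 = m z.2 := by
  rw [← sub_eq_zero]
  refine dotProduct_eq_zero _ fun x => ?_
  rw [dotProduct_comm, dotProduct_sub]
  exact h _ ⟨x, rfl⟩

theorem flat_apply_eq_zero {z : V × V} {m : V → Vec3} (h : m z.1 = m z.2) :
    ∀ f ∈ flat z, f m = 0 := by
  rintro _ ⟨x, rfl⟩
  change x ⬝ᵥ m z.1 - x ⬝ᵥ m z.2 = 0
  rw [h, sub_self]

/-- The functionals whose vanishing says that all vertices have the same value under `φ`. -/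
def levelSpan (φ : Vec3) (v₀ : V) : Submodule ℝ (Dual ℝ (V → Vec3)) :=
  Submodule.span ℝ (Set.range fun v => rowAt v φ - rowAt v₀ φ)

/-- The generator at `v₀` itself is zero. -/
theorem finrank_levelSpan_lt [Fintype V] (φ : Vec3) (v₀ : V) :
    finrank ℝ (levelSpan φ v₀) + 1 ≤ Fintype.card V := by
  classical
  have h1 := finrank_span_finset_le_card (R := ℝ)
    ((Finset.univ.erase v₀).image fun v => rowAt v φ - rowAt v₀ φ)
  have h2 := Finset.card_image_le (s := Finset.univ.erase v₀) (f := fun v => rowAt v φ - rowAt v₀ φ)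
  rw [Finset.card_erase_of_mem (Finset.mem_univ v₀), Finset.card_univ] at h2
  have h3 : levelSpan φ v₀ ≤ Submodule.span ℝ
      ((Finset.univ.erase v₀).image fun v => rowAt v φ - rowAt v₀ φ : Finset _) := by
    refine Submodule.span_le.2 ?_
    rintro _ ⟨v, rfl⟩
    rcases eq_or_ne v v₀ with rfl | hv
    · simp
    · exact Submodule.subset_span (by
        rw [Finset.mem_coe]
        exact Finset.mem_image_of_mem _ (Finset.mem_erase.2 ⟨hv, Finset.mem_univ _⟩))
  have h4 := Submodule.finrank_mono h3
  have h5 : 0 < Fintype.card V := Fintype.card_pos_iff.2 ⟨v₀⟩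
  rw [Set.finrank] at h1
  omega

end Flats

namespace RootedGraph

variable {V E R : Type*} (G : RootedGraph V E R)

/-- The functionals given by the boundary-bars. -/
def rootSpan (n : R → Vec3) : Submodule ℝ (Dual ℝ (V → Vec3)) :=
  Submodule.span ℝ (Set.range fun r => rowAt (G.root r) (n r))

theorem finrank_rootSpan_le [Fintype R] (n : R → Vec3) :
    finrank ℝ (G.rootSpan n) ≤ Fintype.card R :=
  finrank_range_le_card _

/-- The flats of a rooted graph: for every edge and every pair of distinct vertices the comparison
of the two ends, and the level functional at a vertex. -/
noncomputable def flats (φ : Vec3) (v₀ : V) :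
    Option (E ⊕ {z : V × V // z.1 ≠ z.2}) → Submodule ℝ (Dual ℝ (V → Vec3))
  | none => ℝ ∙ rowAt v₀ φ
  | some k => flat (Sum.elim G.endPair Subtype.val k)

open Classical in
-- The rank hypothesis of Dilworth truncation in dual form: the common kernel of S and the flats in
-- F consists of assignments constant on the components of F, to which the count over classes
-- applies. A nonempty F either forces level zero or joins two vertices, so ε = 0 is allowed; the
-- empty family needs ε = 1 and gives the lower bound for dim S.
theorem finrank_add_card_le_finrank_sup_flats [Fintype V] [Fintype E] [Fintype R]
    (n : R → Vec3) (φ : Vec3) (v₀ : V) (hli : ∀ v, LinearIndependent ℝ fun r : G.rootsAt v => n r)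
    (hφv : ∀ v, φ ∉ Submodule.span ℝ (n '' G.rootsAt v))
    (hcount : ∀ X : Set V, X.Nontrivial → ∀ F : Set E, G.vertsOf F ⊆ X →
      (F.ncard : ℤ) ≤ G.maxEdges n X)
    (F : Finset (Option (E ⊕ {z : V × V // z.1 ≠ z.2}))) (ε : ℕ) (hε : ε = 0 → F.Nonempty) :
    Fintype.card V + Fintype.card R +
        (F ∩ (Finset.univ.image fun e => some (Sum.inl e))).card ≤
      finrank ℝ ↥(levelSpan φ v₀ ⊔ G.rootSpan n ⊔ F.sup (G.flats φ v₀)) + ε := by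
  let pr : E ⊕ {z : V × V // z.1 ≠ z.2} → V × V := Sum.elim G.endPair Subtype.val
  have hpr : ∀ k, (pr k).1 ≠ (pr k).2 := Sum.rec G.endPair_ne Subtype.prop
  -- The connected components of the pairs whose flats are in F.
  let s : Setoid V := Relation.EqvGen.setoid fun u v => ∃ k, some k ∈ F ∧ pr k = (u, v)
  have hs : ∀ k, some k ∈ F → s (pr k).1 (pr k).2 := fun k hk => .rel _ _ ⟨k, hk, rfl⟩
  set S := levelSpan φ v₀ ⊔ G.rootSpan n ⊔ F.sup (G.flats φ v₀) with hS
  have hM : ∀ m ∈ S.dualCoannihilator, ∀ f ∈ S, f m = 0 := fun m hm =>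
    (Submodule.mem_dualCoannihilator m).1 hm
  have hFS : ∀ i ∈ F, G.flats φ v₀ i ≤ S := fun i hi => (Finset.le_sup hi).trans le_sup_right
  have hκ : ∀ m ∈ S.dualCoannihilator, ∀ v, φ ⬝ᵥ m v = φ ⬝ᵥ m v₀ := fun m hm v => by
    have := hM m hm (rowAt v φ - rowAt v₀ φ)
      ((le_sup_left.trans le_sup_left : levelSpan φ v₀ ≤ S) (Submodule.subset_span ⟨v, rfl⟩))
    exact sub_eq_zero.1 this
  have hn : ∀ m ∈ S.dualCoannihilator, ∀ r, n r ⬝ᵥ m (G.root r) = 0 := fun m hm r =>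
    hM m hm (rowAt (G.root r) (n r))
      ((le_sup_right.trans le_sup_left : G.rootSpan n ≤ S) (Submodule.subset_span ⟨r, rfl⟩))
  have hconst : ∀ m ∈ S.dualCoannihilator, ∀ u v, s u v → m u = m v := by
    intro m hm u v huv
    induction huv with
    | rel u v h =>
      obtain ⟨k, hk, hkp⟩ := h
      have := apply_eq_of_flat (z := pr k) fun f hf => hM m hm f (hFS _ hk hf)
      rwa [hkp] at this
    | refl => rfl
    | symm _ _ _ ih => exact ih.symm
    | trans _ _ _ _ _ ih1 ih2 => exact ih1.trans ih2
  have h1 := G.finrank_add_ncard_le n φ v₀ hli hφv hcount s S.dualCoannihilator hconst hκ hn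
    {e | some (Sum.inl e) ∈ F} (fun e he => hs (Sum.inl e) he) ε (by
      rintro h0 ⟨m, hm, hm0⟩
      obtain ⟨i, hi⟩ := hε h0
      cases i with
      | none =>
        exact absurd (hM m hm _ (hFS _ hi (Submodule.mem_span_singleton_self _))) hm0
      | some k => exact ⟨_, _, hpr k, hs k hi⟩)
  have h2 := Subspace.finrank_add_finrank_dualCoannihilator_eq S
  rw [finrank_assignment] at h2
  have h3 : (F ∩ (Finset.univ.image fun e => some (Sum.inl e))).card =
      {e : E | (some (Sum.inl e) : Option (E ⊕ {z : V × V // z.1 ≠ z.2})) ∈ F}.ncard := by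
    rw [← Set.ncard_coe_finset, ← Set.ncard_image_of_injective
      {e : E | (some (Sum.inl e) : Option (E ⊕ {z : V × V // z.1 ≠ z.2})) ∈ F}
      ((Option.some_injective _).comp Sum.inl_injective)]
    congr 1
    ext i
    simp only [Finset.coe_inter, Finset.coe_image, Finset.coe_univ, Set.image_univ, Set.mem_inter_iff,
      Finset.mem_coe, Set.mem_range, Set.mem_image, Set.mem_ofPred_eq, Function.comp]
    constructor
    · rintro ⟨hi, e, rfl⟩
      exact ⟨e, hi, rfl⟩
    · rintro ⟨e, hi, rfl⟩
      exact ⟨hi, e, rfl⟩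
  rw [Nat.card_eq_fintype_card, Nat.card_eq_fintype_card] at h1
  omega

/-- The point q is read off from a hyperplane T of functionals: those in T are the linear conditions
that q satisfies, and the flats not inside T give the nondegeneracy of q. -/
theorem exists_generic_placement [Fintype V] [Fintype E] [Fintype R]
    (n : R → Vec3) (φ : Vec3) (v₀ : V) (hli : ∀ v, LinearIndependent ℝ fun r : G.rootsAt v => n r)
    (hφv : ∀ v, φ ∉ Submodule.span ℝ (n '' G.rootsAt v))
    (hcount : ∀ X : Set V, X.Nontrivial → ∀ F : Set E, G.vertsOf F ⊆ X →
      (F.ncard : ℤ) ≤ G.maxEdges n X)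
    (hcard : Fintype.card E + Fintype.card R = 2 * Fintype.card V) :
    ∃ q : V → Vec3, φ ⬝ᵥ q v₀ ≠ 0 ∧ (∀ v, φ ⬝ᵥ q v = φ ⬝ᵥ q v₀) ∧
      (∀ r, n r ⬝ᵥ q (G.root r) = 0) ∧ Function.Injective q ∧
      ∃ x : E → Vec3, (∀ e, x e ⬝ᵥ q (G.endPair e).1 = x e ⬝ᵥ q (G.endPair e).2) ∧
        3 * Fintype.card V ≤ finrank ℝ ↥(levelSpan φ v₀ ⊔ G.rootSpan n ⊔ Submodule.span ℝ
          (Set.range fun e => rowAt (G.endPair e).1 (x e) - rowAt (G.endPair e).2 (x e))) + 1 := by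
  classical
  set S := levelSpan φ v₀ ⊔ G.rootSpan n with hS
  let J : Finset (Option (E ⊕ {z : V × V // z.1 ≠ z.2})) :=
    Finset.univ.image fun e => some (Sum.inl e)
  have hJ : J.card = Fintype.card E :=
    (Finset.card_image_of_injective _ ((Option.some_injective _).comp Sum.inl_injective)).trans
      Finset.card_univ
  have hSle : finrank ℝ S + 1 ≤ Fintype.card V + Fintype.card R := by
    have h1 := Submodule.finrank_sup_add_finrank_inf_eq (levelSpan φ v₀) (G.rootSpan n)
    have h2 := finrank_levelSpan_lt φ v₀
    have h3 := G.finrank_rootSpan_le n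
    rw [← hS] at h1
    omega
  have hSge : Fintype.card V + Fintype.card R ≤ finrank ℝ S + 1 := by
    have := G.finrank_add_card_le_finrank_sup_flats n φ v₀ hli hφv hcount ∅ 1
      (fun h => absurd h one_ne_zero)
    rwa [Finset.empty_inter, Finset.card_empty, Finset.sup_empty, sup_bot_eq] at this
  obtain ⟨T, hST, hTdim, hAT, y, hy, hTy⟩ := exists_generic_transversal (G.flats φ v₀) J S
    fun F hF => by
      have := G.finrank_add_card_le_finrank_sup_flats n φ v₀ hli hφv hcount F 0 (fun _ => hF)
      rw [← hS] at this
      change _ + _ + (F ∩ J).card ≤ _ at this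
      omega
  -- T is proper since it misses the level functional, and dim T ≥ (|V| + |R| - 1) + |E| = 3|V| - 1.
  obtain ⟨q, hq⟩ := Submodule.exists_forall_mem_iff_apply_eq_zero (T := T)
    (fun h => hAT none (h ▸ le_top)) (by rw [finrank_assignment]; omega)
  have hyJ : ∀ e, ∃ x, rowAt (G.endPair e).1 x - rowAt (G.endPair e).2 x = y (some (Sum.inl e)) :=
    fun e => hy _ (Finset.mem_image_of_mem _ (Finset.mem_univ e))
  choose x hx using hyJ
  have hyT : ∀ j ∈ J, y j ∈ T := fun j hj => by
    rw [hTy]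
    exact Submodule.mem_sup_right (Submodule.subset_span ⟨j, hj, rfl⟩)
  refine ⟨q, ?_, ?_, ?_, ?_, x, ?_, ?_⟩
  · intro h0
    refine hAT none ((Submodule.span_singleton_le_iff_mem _ _).2 ((hq _).2 h0))
  · intro v
    have := (hq (rowAt v φ - rowAt v₀ φ)).1
      (hST ((le_sup_left : levelSpan φ v₀ ≤ S) (Submodule.subset_span ⟨v, rfl⟩)))
    exact sub_eq_zero.1 this
  · intro r
    exact (hq (rowAt (G.root r) (n r))).1
      (hST ((le_sup_right : G.rootSpan n ≤ S) (Submodule.subset_span ⟨r, rfl⟩)))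
  · intro u v huv
    by_contra hne
    refine hAT (some (Sum.inr ⟨(u, v), hne⟩)) fun f hf => (hq f).2 ?_
    exact flat_apply_eq_zero (z := (u, v)) huv f hf
  · intro e
    have := (hq _).1 (hyT _ (Finset.mem_image_of_mem _ (Finset.mem_univ e)))
    rw [← hx e] at this
    exact sub_eq_zero.1 this
  · have h1 := Submodule.finrank_mono hTy.le
    have h2 : y '' J = Set.range fun e =>
        rowAt (G.endPair e).1 (x e) - rowAt (G.endPair e).2 (x e) := by
      rw [Finset.coe_image, Finset.coe_univ, Set.image_univ, ← Set.range_comp]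
      congr 1
      funext e
      exact (hx e).symm
    rw [h2] at h1
    omega

/-! ### From the placement to a rigid framework -/

/-- A placement of the joints on their boundary-bars whose rows span a space of the largest
possible dimension gives a minimally infinitesimally rigid framework. -/
theorem exists_isMinInfRigid_of_placement [Fintype V] [Fintype E] [Fintype R] {b₀ : R → ProjLine}
    {φ : Vec3} {v₀ : V} {q : V → Vec3} (hq0 : φ ⬝ᵥ q v₀ ≠ 0) (hq : ∀ v, φ ⬝ᵥ q v = φ ⬝ᵥ q v₀)
    (hinc : ∀ r, normalVec (b₀ r).1 ⬝ᵥ q (G.root r) = 0) (hinj : Function.Injective q)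
    {x : E → Vec3} (hx : ∀ e, x e ⬝ᵥ q (G.endPair e).1 = x e ⬝ᵥ q (G.endPair e).2)
    (hdim : 3 * Fintype.card V ≤ finrank ℝ ↥(levelSpan φ v₀ ⊔
      G.rootSpan (fun r => normalVec (b₀ r).1) ⊔ Submodule.span ℝ
          (Set.range fun e => rowAt (G.endPair e).1 (x e) - rowAt (G.endPair e).2 (x e))) + 1)
    (hcard : Fintype.card E + Fintype.card R = 2 * Fintype.card V) :
    ∃ p : V → ProjPlane, G.IsBarJointFramework p b₀ ∧ G.IsMinInfRigid p b₀ := by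
  classical
  have hne : ∀ v, q v ≠ 0 := fun v h => hq0 (by rw [← hq v, h, dotProduct_zero])
  let p : V → ProjPlane := fun v => Projectivization.mk ℝ (q v) (hne v)
  have hp : G.IsBarJointFramework p b₀ := by
    constructor
    · intro u v huv
      obtain ⟨a, ha⟩ := (Projectivization.mk_eq_mk_iff' ℝ _ _ (hne u) (hne v)).1 huv
      have h1 := hq u
      rw [← ha, dotProduct_smul, hq v, smul_eq_mul] at h1
      -- Proportional vectors of the same nonzero level are equal, so distinct vectors give distinct
      -- points.
      have h2 : a = 1 := mul_right_cancel₀ hq0 (h1.trans (one_mul _).symm)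
      rw [h2, one_smul] at ha
      exact hinj ha.symm
    · intro r
      rw [incident_iff]
      obtain ⟨a, ha⟩ := Projectivization.exists_smul_eq_mk_rep ℝ (q (G.root r)) (hne _)
      change _ ⬝ᵥ (Projectivization.mk ℝ (q (G.root r)) (hne _)).rep = 0
      rw [← ha, Units.smul_def, dotProduct_smul, hinc, smul_zero]
  refine ⟨p, hp, (G.isMinInfRigid_iff hp).2 ⟨?_, hcard⟩⟩
  set ρ := G.rigidityRow (G.bar p) (fun r => pluckerVec (b₀ r).1)
  rw [linearIndependent_iff_card_le_finrank_span, Fintype.card_sum, hcard, Set.finrank]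
  have hroot : G.rootSpan (fun r => normalVec (b₀ r).1) ≤ Submodule.span ℝ (Set.range ρ) := by
    refine Submodule.span_le.2 ?_
    rintro _ ⟨r, rfl⟩
    exact Submodule.subset_span ⟨Sum.inr r, rfl⟩
  have hedge : Submodule.span ℝ
      (Set.range fun e => rowAt (G.endPair e).1 (x e) - rowAt (G.endPair e).2 (x e)) ≤
      levelSpan φ v₀ ⊔ Submodule.span ℝ (Set.range ρ) := by
    refine Submodule.span_le.2 ?_
    rintro _ ⟨e, rfl⟩
    set u := (G.endPair e).1
    set v := (G.endPair e).2
    -- x e takes equal values at q u and q v; subtracting c • φ makes both zero, so the rest is a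
    -- multiple of the normal of the bar. The φ-part is absorbed by `levelSpan`.
    set c := (x e ⬝ᵥ q u) / (φ ⬝ᵥ q v₀)
    have hc : ∀ w, x e ⬝ᵥ q w = x e ⬝ᵥ q u → (x e - c • φ) ⬝ᵥ q w = 0 := fun w hw => by
      rw [sub_dotProduct, smul_dotProduct, hq, hw, smul_eq_mul, div_mul_cancel₀ _ hq0, sub_self]
    have h2 : finrank ℝ ↥((p u).submodule ⊔ (p v).submodule) = 2 :=
      Projectivization.finrank_submodule_sup (hp.1.ne (G.endPair_ne e))
    obtain ⟨a, ha⟩ := exists_smul_normalVec_eq h2 (y := x e - c • φ) (by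
      intro y hy
      obtain ⟨y₁, hy₁, y₂, hy₂, rfl⟩ := Submodule.mem_sup.1 hy
      rw [Projectivization.submodule_mk] at hy₁ hy₂
      obtain ⟨t₁, rfl⟩ := Submodule.mem_span_singleton.1 hy₁
      obtain ⟨t₂, rfl⟩ := Submodule.mem_span_singleton.1 hy₂
      rw [dotProduct_add, dotProduct_smul, dotProduct_smul, hc u rfl, hc v (hx e).symm, smul_zero,
        smul_zero, add_zero])
    have hbar : ρ (Sum.inl e) = rowAt u (normalVec ((p u).submodule ⊔ (p v).submodule)) -
        rowAt v (normalVec ((p u).submodule ⊔ (p v).submodule)) := by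
      rw [← G.hodgeStar_bar p e]
      rfl
    have hrow : rowAt u (x e) - rowAt v (x e) =
        (c • (rowAt u φ - rowAt v₀ φ) - c • (rowAt v φ - rowAt v₀ φ)) + a • ρ (Sum.inl e) := by
      have h3 : x e = c • φ + a • normalVec ((p u).submodule ⊔ (p v).submodule) := by
        rw [ha]
        abel
      rw [hbar, h3]
      simp only [map_add, map_smul]
      module
    change rowAt u (x e) - rowAt v (x e) ∈ _
    rw [hrow]
    exact Submodule.add_mem_sup
      (Submodule.sub_mem _ (Submodule.smul_mem _ _ (Submodule.subset_span ⟨u, rfl⟩))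
        (Submodule.smul_mem _ _ (Submodule.subset_span ⟨v, rfl⟩)))
      (Submodule.smul_mem _ _ (Submodule.subset_span ⟨Sum.inl e, rfl⟩))
  -- The level functionals account for at most |V| - 1 of the 3|V| - 1 dimensions, so the rows have
  -- rank at least 2|V| = |E| + |R|.
  have h1 := Submodule.finrank_mono (sup_le (sup_le le_sup_left (hroot.trans le_sup_right)) hedge)
  have h2 := Submodule.finrank_add_le_finrank_add_finrank (levelSpan φ v₀)
    (Submodule.span ℝ (Set.range ρ))
  have h3 := finrank_levelSpan_lt φ v₀
  omega

/-- A vector outside of the spans of the normal vectors at the vertices. -/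
theorem exists_forall_notMem_span_rootsAt [Finite V] [Finite R] (n : R → Vec3)
    (h2 : ∀ v, (G.rootsAt v).ncard ≤ 2) (hli : ∀ v, LinearIndependent ℝ fun r : G.rootsAt v => n r) :
    ∃ φ : Vec3, ∀ v, φ ∉ Submodule.span ℝ (n '' G.rootsAt v) := by
  refine Submodule.exists_forall_notMem_of_forall_ne_top _ fun v hv => ?_
  have h3 := G.finrank_span_rootsAt (hli v)
  rw [hv, finrank_top, finrank_fin_fun] at h3
  have := h2 v
  omega

end RootedGraph

/-! ### The characterization -/

theorem mainTheorem8 {V E R : Type*} [Finite V] [Finite E] [Finite R]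
    (G : RootedGraph V E R) (b₀ : R → ProjLine)
    (hgen : InGeneralPosition (Set.range b₀))
    -- no two vertices carry the same pair of distinct boundary lines
    (hsep : ∀ r r' s s' : R, G.root r = G.root r' → G.root s = G.root s' →
      b₀ r ≠ b₀ r' → b₀ s = b₀ r → b₀ s' = b₀ r' → G.root s = G.root r) :
    (∃ p : V → ProjPlane, G.IsBarJointFramework p b₀ ∧ G.IsMinInfRigid p b₀) ↔
      (∀ v : V, (G.rootsAt v).ncard ≤ 2 ∧
          LinearIndependent ℝ (fun r : G.rootsAt v => pluckerVec (b₀ r).1)) ∧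
        (∀ F : Set E, F.Nonempty →
          (F.ncard : ℤ) + (G.rootsOf F).ncard ≤ 2 * (G.vertsOf F).ncard - 3 +
            Module.finrank ℝ
              (Submodule.span ℝ ((fun r => pluckerVec (b₀ r).1) '' G.rootsOf F))) ∧
        Nat.card E + Nat.card R = 2 * Nat.card V := by
  classical
  have := Fintype.ofFinite V
  have := Fintype.ofFinite E
  have := Fintype.ofFinite R
  rw [Nat.card_eq_fintype_card, Nat.card_eq_fintype_card, Nat.card_eq_fintype_card]
  constructor
  · rintro ⟨p, hp, hmin⟩
    obtain ⟨hli, hcard⟩ := (G.isMinInfRigid_iff hp).1 hmin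
    have hv := fun v => G.linearIndependent_rootsAt hli v
    exact ⟨fun v => ⟨G.ncard_rootsAt_le_two hp v (hv v), hv v⟩,
      fun F hF => G.ncard_add_ncard_rootsOf_le hp hli hF, hcard⟩
  · rintro ⟨hv, hF, hcard⟩
    have h2 := fun v => (hv v).1
    have hli : ∀ v, LinearIndependent ℝ fun r : G.rootsAt v => normalVec (b₀ r).1 := fun v =>
      (RootedGraph.linearIndependent_normalVec_iff b₀ (G.rootsAt v)).2 (hv v).2
    -- The chart needs a base vertex; without vertices there are neither edges nor roots.
    rcases isEmpty_or_nonempty V with hV | ⟨⟨v₀⟩⟩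
    · have hE : IsEmpty E := ⟨fun e => hV.elim (G.endPair e).1⟩
      have hR : IsEmpty R := ⟨fun r => hV.elim (G.root r)⟩
      exact ⟨fun v => hV.elim v, ⟨fun v => hV.elim v, fun r => hR.elim r⟩,
        fun m _ => by rw [Subsingleton.elim m 0]; exact Submodule.zero_mem _,
        fun e => hE.elim e, fun r => hR.elim r⟩
    · obtain ⟨φ, hφ⟩ := G.exists_forall_notMem_span_rootsAt (fun r => normalVec (b₀ r).1) h2 hli
      obtain ⟨q, hq0, hq, hinc, hinj, x, hx, hdim⟩ := G.exists_generic_placement (fun r => normalVec (b₀ r).1) φ v₀ hli hφ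
        (fun X hX F hFX => G.ncard_le_maxEdges hgen hsep h2 hli hF hX hFX) hcard
      exact G.exists_isMinInfRigid_of_placement hq0 hq hinc hinj hx hdim hcard
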